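/- Let $n\ge 1$ and let $\varphi:(0,\infty)\to[0,\infty)$ be a (Lebesgue) measurable function. For a measurable function $f$ on $\mathbb R^n$ let $$f^*(t)=\inf\{\alpha>0:\ |\{x\in\mathbb R^n:|f(x)|>\alpha\}|\le t\}\quad(t>0,\ \inf\emptyset=\infty),\qquad \|f\|_{\Lambda^{\varphi,\infty}}=\operatorname*{ess\,sup}_{t>0}\varphi(t)f^*(t),$$ and let $\Lambda^{\varphi,\infty}(\mathbb R^n)$ be the set of all measurable $f:\mathbb R^n\to\mathbb R$ with $\|f\|_{\Lambda^{\varphi,\infty}}<\infty$. Let $M$ be the Hardy--Littlewood maximal operator, $$Mf(x)=\sup_{Q\ni x}\frac1{|Q|}\int_Q|f(y)|\,dy\in[0,\infty],$$ where the supremum is over all cubes $Q$ containing $x$ with sides parallel to the coordinate axes. Then $M$ is bounded on $\Lambda^{\varphi,\infty}(\mathbb R^n)$, that is, there is a finite constant $C$ with $\|Mf\|_{\Lambda^{\varphi,\infty}}\le C\|f\|_{\Lambda^{\varphi,\infty}}$ for all $f\in\Lambda^{\varphi,\infty}(\mathbb R^n)$, if and only if $$\operatorname*{ess\,sup}_{t>0}\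 \frac{\varphi(t)}t\int_0^t\frac{ds}{\operatorname*{ess\,sup}_{0<\tau<s}\varphi(\tau)}<\infty .$$ Here all quantities take values in $[0,\infty]$, with $1/0=\infty$, $1/\infty=0$ and $0\cdot\infty=0$. -/

import Mathlib

open MeasureTheory Set
open scoped NNReal ENNReal

noncomputable section

namespace GenLorentz

/-- The closed cube in `ℝⁿ` with sides parallel to the coordinate axes, centre `c` and
side length `2 * r`. -/
def cube {n : ℕ} (c : Fin n → ℝ) (r : ℝ) : Set (Fin n → ℝ) :=
  Icc (fun i => c i - r) (fun i => c i + r)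

/-- The (uncentred) Hardy-Littlewood maximal function over all cubes `Q` (of positive side length)
that contain `x`: the supremum of `|Q|⁻¹ ∫_Q |f|`, a value in `[0, ∞]`. -/
def maximal {n : ℕ} (f : (Fin n → ℝ) → ℝ) (x : Fin n → ℝ) : ℝ≥0∞ :=
  ⨆ (c : Fin n → ℝ) (r : ℝ) (_ : 0 < r) (_ : x ∈ cube c r),
    (volume (cube c r))⁻¹ * ∫⁻ y in cube c r, ‖f y‖ₑ

/-- The distribution function `m(g, α) = |{x : g x > α}|` of a `[0, ∞]`-valued function. -/
def distribution {n : ℕ} (g : (Fin n → ℝ) → ℝ≥0∞) (α : ℝ≥0) : ℝ≥0∞ :=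
  volume {x | (α : ℝ≥0∞) < g x}

/-- The decreasing rearrangement `g*(t) = inf {α > 0 : m(g, α) ≤ t}`, with `inf ∅ = ∞`. -/
def rearrangement {n : ℕ} (g : (Fin n → ℝ) → ℝ≥0∞) (t : ℝ) : ℝ≥0∞ :=
  ⨅ (α : ℝ≥0) (_ : 0 < α) (_ : distribution g α ≤ ENNReal.ofReal t), (α : ℝ≥0∞)

/-- The functional `ess sup_{t > 0} φ(t) g*(t)`, for a `[0, ∞]`-valued function `g`
(the absolute value of a measurable function, or a maximal function). -/
def lorentzNorm {n : ℕ} (φ : ℝ → ℝ≥0) (g : (Fin n → ℝ) → ℝ≥0∞) : ℝ≥0∞ :=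
  essSup (fun t => (φ t : ℝ≥0∞) * rearrangement g t) (volume.restrict (Ioi (0 : ℝ)))

/-- The generalized Lorentz space `Λ^{φ,∞}(ℝⁿ)`: the (Lebesgue) measurable functions `f` with
`ess sup_{t > 0} φ(t) f*(t) < ∞`. -/
def lorentzSpace (n : ℕ) (φ : ℝ → ℝ≥0) : Set ((Fin n → ℝ) → ℝ) :=
  {f | AEMeasurable f volume ∧ lorentzNorm φ (fun x => ‖f x‖ₑ) < ∞}

/-- The Hardy-Littlewood maximal operator is bounded on `Λ^{φ,∞}(ℝⁿ)`. -/
def MaximalBounded (n : ℕ) (φ : ℝ → ℝ≥0) : Prop :=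
  ∃ C : ℝ≥0, ∀ f ∈ lorentzSpace n φ,
    lorentzNorm φ (maximal f) ≤ C * lorentzNorm φ (fun x => ‖f x‖ₑ)

end GenLorentz

end

open Filter
open scoped Topology

namespace GenLorentz

/-! Write Φ(s) for the essential supremum of φ over (0, s). Two facts carry the theorem: (Mf)* is
comparable to the running average of f*, and since f* decreases, φ may be replaced by Φ.

Sufficiency. `rearrangement_maximal_le` gives (Mf)*(t) ≤ (5^n + 1) t⁻¹ ∫₀ᵗ f*, by applying the weak
type (1, 1) inequality to the part of |f| above the level f*(t). Apart from a degenerate case,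
`runningEssSup_mul_rearrangement_le` gives f* ≤ ‖f‖/Φ; inserting this produces exactly the integral
in the condition.

Necessity. The extremal function should have rearrangement 1/Φ. The radial function with profile
min(1/Φ, k) in the variable `cubeVolume` has norm at most 1, because φ ≤ Φ almost everywhere. Its
maximal function has a rearrangement at t of at least (3t)⁻¹ times the integral of the profile over
(0, t). Boundedness yields a bound 3C independent of k, and k → ∞ gives the condition. The
truncation keeps the test functions real-valued where Φ vanishes. -/

/-! ### Cubes and the weak type (1, 1) inequality -/

theorem cube_eq_closedBall {n : ℕ} (c : Fin n → ℝ) {r : ℝ} (hr : 0 ≤ r) :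
    cube c r = Metric.closedBall c r := by
  ext x
  simp only [cube, mem_Icc, Pi.le_def, Metric.mem_closedBall, dist_pi_le_iff hr, Real.dist_eq,
    abs_le]
  constructor
  · rintro ⟨h1, h2⟩ i
    constructor <;> linarith [h1 i, h2 i]
  · intro h
    constructor <;> intro i <;> linarith [(h i).1, (h i).2]

theorem volume_cube {n : ℕ} (c : Fin n → ℝ) {r : ℝ} (hr : 0 ≤ r) :
    volume (cube c r) = ENNReal.ofReal ((2 * r) ^ n) := by
  rw [cube_eq_closedBall c hr, Real.volume_pi_closedBall c hr, Fintype.card_fin]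

theorem volume_cube_ne_zero {n : ℕ} (c : Fin n → ℝ) {r : ℝ} (hr : 0 < r) :
    volume (cube c r) ≠ 0 := by
  rw [volume_cube c hr.le]
  exact (ENNReal.ofReal_pos.2 (by positivity)).ne'

theorem volume_cube_ne_top {n : ℕ} (c : Fin n → ℝ) {r : ℝ} (hr : 0 < r) :
    volume (cube c r) ≠ ∞ := by
  rw [volume_cube c hr.le]
  exact ENNReal.ofReal_ne_top

/-- Weak type `(1, 1)` inequality for the uncentred maximal operator over cubes. -/
theorem volume_exists_cube_lintegral_gt_le {n : ℕ} (hn : 1 ≤ n) (h : (Fin n → ℝ) → ℝ≥0∞)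
    {a : ℝ≥0∞} (ha : a ≠ 0) (ha' : a ≠ ∞) :
    volume {x | ∃ c r, 0 < r ∧ x ∈ cube c r ∧ a * volume (cube c r) < ∫⁻ y in cube c r, h y} ≤
      5 ^ n * (a⁻¹ * ∫⁻ y, h y) := by
  rcases eq_or_ne (∫⁻ y, h y) ∞ with hI | hI
  · rw [hI, ENNReal.mul_top (ENNReal.inv_ne_zero.2 ha'), ENNReal.mul_top (by positivity)]
    exact le_top
  have hvol : ∀ c r, a * volume (cube c r) < ∫⁻ y in cube c r, h y →
      volume (cube c r) ≤ a⁻¹ * ∫⁻ y in cube c r, h y := by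
    intro c r hlt
    rw [mul_comm, ← div_eq_mul_inv, ENNReal.le_div_iff_mul_le (Or.inl ha) (Or.inl ha'), mul_comm]
    exact hlt.le
  let t : Set ((Fin n → ℝ) × ℝ) :=
    {p | 0 < p.2 ∧ a * volume (cube p.1 p.2) < ∫⁻ y in cube p.1 p.2, h y}
  have hB : a⁻¹ * ∫⁻ y, h y ≠ ∞ := ENNReal.mul_ne_top (ENNReal.inv_ne_top.2 ha) hI
  -- The Vitali lemma needs bounded radii: the volume (2r)^n is bounded, and it dominates 2r once 2r
  -- ≥ 1.
  have hR : ∀ p ∈ t, p.2 ≤ 1 + (a⁻¹ * ∫⁻ y, h y).toReal := by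
    rintro ⟨c, r⟩ ⟨hr, hlt⟩
    have h1 : volume (cube c r) ≤ a⁻¹ * ∫⁻ y, h y :=
      (hvol c r hlt).trans (by gcongr; exact Measure.restrict_le_self)
    rw [volume_cube c hr.le, ENNReal.ofReal_le_iff_le_toReal hB] at h1
    dsimp only at hr ⊢
    rcases le_total (2 * r) 1 with h2 | h2
    · linarith [ENNReal.toReal_nonneg (a := a⁻¹ * ∫⁻ y, h y)]
    · linarith [le_self_pow₀ h2 (by omega : n ≠ 0)]
  obtain ⟨u, hut, hdis, hcov⟩ := Vitali.exists_disjoint_subfamily_covering_enlargement_closedBall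
    t (fun p => p.1) (fun p => p.2) _ hR 5 (by norm_num)
  have hucount : u.Countable := hdis.countable_of_nonempty_interior fun p hp =>
    ⟨p.1, Metric.ball_subset_interior_closedBall (Metric.mem_ball_self (hut hp).1)⟩
  have hdis' : u.PairwiseDisjoint fun p => cube p.1 p.2 := by
    intro p hp q hq hpq
    have := hdis hp hq hpq
    simpa only [Function.onFun, cube_eq_closedBall _ (hut hp).1.le,
      cube_eq_closedBall _ (hut hq).1.le] using this
  have h5 : ∀ p ∈ u, volume (Metric.closedBall p.1 (5 * p.2)) = 5 ^ n * volume (cube p.1 p.2) := by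
    intro p hp
    have hp0 := (hut hp).1
    rw [← cube_eq_closedBall _ (by positivity), volume_cube _ (by positivity), volume_cube _ hp0.le,
      show (2 * (5 * p.2)) ^ n = 5 ^ n * (2 * p.2) ^ n by rw [← mul_pow]; ring,
      ENNReal.ofReal_mul (by positivity), ENNReal.ofReal_pow (by norm_num)]
    norm_num
  calc _ ≤ volume (⋃ p ∈ u, Metric.closedBall p.1 (5 * p.2)) := by
        refine measure_mono ?_
        rintro x ⟨c, r, hr, hx, hlt⟩
        obtain ⟨q, hq, hsub⟩ := hcov (c, r) ⟨hr, hlt⟩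
        rw [cube_eq_closedBall c hr.le] at hx
        exact mem_biUnion hq (hsub hx)
    _ ≤ ∑' p : u, volume (Metric.closedBall p.1.1 (5 * p.1.2)) := measure_biUnion_le _ hucount _
    _ ≤ ∑' p : u, 5 ^ n * (a⁻¹ * ∫⁻ y in cube p.1.1 p.1.2, h y) := by
        refine ENNReal.tsum_le_tsum fun p => ?_
        rw [h5 p p.2]
        gcongr
        exact hvol _ _ (hut p.2).2
    _ = 5 ^ n * (a⁻¹ * ∫⁻ y in ⋃ p ∈ u, cube p.1 p.2, h y) := by
        rw [ENNReal.tsum_mul_left, ENNReal.tsum_mul_left,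
          lintegral_biUnion (s := fun p => cube p.1 p.2) hucount (fun p _ => measurableSet_Icc) hdis']
    _ ≤ _ := by gcongr; exact Measure.restrict_le_self

/-! ### Rearrangements and the upper bound for (Mf)* -/

theorem distribution_anti {n : ℕ} (g : (Fin n → ℝ) → ℝ≥0∞) : Antitone (distribution g) :=
  fun _ _ hab => measure_mono fun _ hx => (ENNReal.coe_le_coe.2 hab).trans_lt hx

theorem rearrangement_anti {n : ℕ} (g : (Fin n → ℝ) → ℝ≥0∞) : Antitone (rearrangement g) := by
  intro s t hst
  refine iInf_mono fun α => iInf_mono fun _ => ?_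
  exact iInf_mono' fun h => ⟨h.trans (ENNReal.ofReal_le_ofReal hst), le_rfl⟩

theorem distribution_le_of_rearrangement_lt {n : ℕ} {g : (Fin n → ℝ) → ℝ≥0∞} {t : ℝ} {α : ℝ≥0}
    (h : rearrangement g t < α) : distribution g α ≤ ENNReal.ofReal t := by
  simp only [rearrangement, iInf_lt_iff] at h
  obtain ⟨β, _, hβ, hlt⟩ := h
  exact (distribution_anti g (ENNReal.coe_lt_coe.1 hlt).le).trans hβ

theorem rearrangement_le {n : ℕ} {g : (Fin n → ℝ) → ℝ≥0∞} {t : ℝ} {α : ℝ≥0} (h0 : 0 < α)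
    (h : distribution g α ≤ ENNReal.ofReal t) : rearrangement g t ≤ α :=
  iInf_le_of_le α (iInf_le_of_le h0 (iInf_le _ h))

/-- The excess of `|f|` over its rearrangement at `t` is controlled by `∫₀ᵗ f*`. -/
theorem lintegral_sub_le_lintegral_rearrangement {n : ℕ} {f : (Fin n → ℝ) → ℝ}
    (hf : AEMeasurable f volume) {t : ℝ} {l : ℝ≥0}
    (hl : ((l : ℝ≥0) : ℝ≥0∞) = rearrangement (fun x => ‖f x‖ₑ) t)
    (hfin : ∫⁻ s in Ioo 0 t, rearrangement (fun x => ‖f x‖ₑ) s ≠ ∞) :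
    ∫⁻ x, (‖f x‖ₑ - l) ≤ ∫⁻ s in Ioo 0 t, rearrangement (fun x => ‖f x‖ₑ) s := by
  set R := rearrangement (fun x => ‖f x‖ₑ) with hR
  have hRanti : Antitone R := rearrangement_anti _
  have hmeas : Measurable R := hRanti.measurable
  have hae : ∀ᵐ s ∂(volume.restrict (Ioo 0 t)), R s < ∞ := ae_lt_top hmeas hfin
  calc ∫⁻ x, (‖f x‖ₑ - l) = ∫⁻ x, ENNReal.ofReal (max (|f x| - l) 0) := by
        refine lintegral_congr fun x => ?_
        rw [← ofReal_norm, Real.norm_eq_abs, ← ENNReal.ofReal_coe_nnreal (p := l),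
          ← ENNReal.ofReal_sub _ l.coe_nonneg, ENNReal.ofReal_max]
        simp
    _ = ∫⁻ a in Ioi 0, volume {x | a < max (|f x| - l) 0} :=
        lintegral_eq_lintegral_meas_lt _ (.of_forall fun x => le_max_right _ _)
          (((hf.norm).sub_const _).max aemeasurable_const)
    -- Layer by layer: m = |{|f| > l + a}| is at most t because l + a exceeds f*(t), and f* ≥ l + a
    -- ≥ a on (0, m). Passing to `toReal` is harmless because f* is finite almost everywhere on (0,
    -- t).
    _ ≤ ∫⁻ a in Ioi 0, (volume.restrict (Ioo 0 t)) {s | a ≤ (R s).toReal} := by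
        refine setLIntegral_mono' measurableSet_Ioi fun a ha => ?_
        have ha : 0 < a := ha
        lift a to ℝ≥0 using ha.le
        have ha0 : 0 < a := by exact_mod_cast ha
        have hset : {x | (a : ℝ) < max (|f x| - l) 0} = {x | ((l + a : ℝ≥0) : ℝ≥0∞) < ‖f x‖ₑ} := by
          ext x
          rw [mem_ofPred_eq, mem_ofPred_eq, lt_max_iff, or_iff_left (not_lt.2 ha.le), enorm_eq_nnnorm,
            ENNReal.coe_lt_coe, ← NNReal.coe_lt_coe, coe_nnnorm, Real.norm_eq_abs]
          push_cast
          constructor <;> intro h <;> linarith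
        rw [hset]
        change distribution (fun x => ‖f x‖ₑ) (l + a) ≤ _
        have hle : distribution (fun x => ‖f x‖ₑ) (l + a) ≤ ENNReal.ofReal t := by
          refine distribution_le_of_rearrangement_lt ?_
          rw [← hR, ← hl]
          exact_mod_cast lt_add_of_pos_right l ha0
        set m := distribution (fun x => ‖f x‖ₑ) (l + a) with hm
        have hmtop : m ≠ ∞ := ne_top_of_le_ne_top ENNReal.ofReal_ne_top hle
        have hsub : ∀ᵐ s ∂volume, s ∈ Ioo 0 m.toReal → s ∈ {s | (a : ℝ) ≤ (R s).toReal} ∩ Ioo 0 t := by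
          rw [ae_restrict_iff' measurableSet_Ioo] at hae
          filter_upwards [hae] with s hs hsm
          have hmt : m.toReal ≤ max t 0 := by
            have := ENNReal.toReal_mono ENNReal.ofReal_ne_top hle
            rwa [ENNReal.toReal_ofReal'] at this
          have hst : s ∈ Ioo 0 t := by
            refine ⟨hsm.1, ?_⟩
            rcases lt_max_iff.1 (hsm.2.trans_le hmt) with h | h
            · exact h
            · exact absurd hsm.1 h.le.not_gt
          refine ⟨?_, hst⟩
          have h1 : ((l + a : ℝ≥0) : ℝ≥0∞) ≤ R s := by
            by_contra! hcon
            have h2 := distribution_le_of_rearrangement_lt hcon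
            rw [← hm, ENNReal.le_ofReal_iff_toReal_le hmtop hsm.1.le] at h2
            exact h2.not_gt hsm.2
          have h3 := ENNReal.toReal_mono (hs hst).ne h1
          simp only [ENNReal.coe_toReal, NNReal.coe_add] at h3
          change (a : ℝ) ≤ _
          linarith [l.2]
        calc m = volume (Ioo 0 m.toReal) := by
              rw [Real.volume_Ioo, sub_zero, ENNReal.ofReal_toReal hmtop]
          _ ≤ volume ({s | (a : ℝ) ≤ (R s).toReal} ∩ Ioo 0 t) := measure_mono_ae hsub
          _ ≤ _ := Measure.le_restrict_apply _ _
    _ = ∫⁻ s in Ioo 0 t, ENNReal.ofReal (R s).toReal :=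
        (lintegral_eq_lintegral_meas_le _ (.of_forall fun _ => ENNReal.toReal_nonneg)
          hmeas.ennreal_toReal.aemeasurable).symm
    _ ≤ _ := lintegral_mono fun s => ENNReal.ofReal_toReal_le

theorem rearrangement_le_average {n : ℕ} (g : (Fin n → ℝ) → ℝ≥0∞) {t : ℝ} (ht : 0 < t) :
    rearrangement g t ≤ (ENNReal.ofReal t)⁻¹ * ∫⁻ s in Ioo 0 t, rearrangement g s := by
  have h0 : ENNReal.ofReal t ≠ 0 := (ENNReal.ofReal_pos.2 ht).ne'
  rw [mul_comm, ← div_eq_mul_inv,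
    ENNReal.le_div_iff_mul_le (Or.inl h0) (Or.inl ENNReal.ofReal_ne_top)]
  calc rearrangement g t * ENNReal.ofReal t = ∫⁻ _ in Ioo 0 t, rearrangement g t := by simp
    _ ≤ _ := setLIntegral_mono' measurableSet_Ioo fun s hs => rearrangement_anti g hs.2.le

/-- The rearrangement of the maximal function is controlled by the average of the rearrangement. -/
theorem rearrangement_maximal_le {n : ℕ} (hn : 1 ≤ n) {f : (Fin n → ℝ) → ℝ}
    (hf : AEMeasurable f volume) {t : ℝ} (ht : 0 < t) :
    rearrangement (maximal f) t ≤ (5 ^ n + 1) *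
      ((ENNReal.ofReal t)⁻¹ * ∫⁻ s in Ioo 0 t, rearrangement (fun x => ‖f x‖ₑ) s) := by
  have h0 : ENNReal.ofReal t ≠ 0 := (ENNReal.ofReal_pos.2 ht).ne'
  set J := ∫⁻ s in Ioo 0 t, rearrangement (fun x => ‖f x‖ₑ) s with hJ
  set A := (ENNReal.ofReal t)⁻¹ * J with hA
  have hJA : J = ENNReal.ofReal t * A := by
    rw [hA, ← mul_assoc, ENNReal.mul_inv_cancel h0 ENNReal.ofReal_ne_top, one_mul]
  rcases eq_or_ne A ∞ with hAt | hAt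
  · rw [hAt, ENNReal.mul_top (by positivity)]
    exact le_top
  have hJt : J ≠ ∞ := by rw [hJA]; exact ENNReal.mul_ne_top ENNReal.ofReal_ne_top hAt
  have hRA := rearrangement_le_average (fun x => ‖f x‖ₑ) ht
  rw [← hJ, ← hA] at hRA
  obtain ⟨l, hl⟩ : ∃ l : ℝ≥0, (l : ℝ≥0∞) = rearrangement (fun x => ‖f x‖ₑ) t :=
    ⟨_, ENNReal.coe_toNNReal (ne_top_of_le_ne_top hAt hRA)⟩
  have hint := lintegral_sub_le_lintegral_rearrangement hf hl hJt
  rw [← hJ] at hint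
  rw [← hl] at hRA
  refine le_of_forall_gt_imp_ge_of_dense fun b hb => ?_
  rcases eq_or_ne b ∞ with rfl | hbt
  · exact le_top
  lift b to ℝ≥0 using hbt
  have hb0 : 0 < b := ENNReal.coe_pos.1 (bot_le.trans_lt hb)
  refine rearrangement_le hb0 ?_
  -- The level l = f*(t) is at most the average A of f* over (0, t), which accounts for the extra 1
  -- in 5^n + 1. A cube on which |f| has average above b then has average of (|f| - l)₊ above b - l
  -- ≥ 5^n A.
  have hkey : 5 ^ n * A + l < b := by
    refine lt_of_le_of_lt ?_ hb
    rw [add_mul, one_mul]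
    gcongr
  have hlb : (l : ℝ≥0∞) < b := lt_of_le_of_lt le_add_self hkey
  have hd0 : (b : ℝ≥0∞) - l ≠ 0 := (tsub_pos_of_lt hlb).ne'
  have hdt : (b : ℝ≥0∞) - l ≠ ∞ := ENNReal.sub_ne_top ENNReal.coe_ne_top
  have hdA : 5 ^ n * A ≤ (b : ℝ≥0∞) - l := ENNReal.le_sub_of_add_le_right ENNReal.coe_ne_top hkey.le
  calc distribution (maximal f) b
      ≤ volume {x | ∃ c r, 0 < r ∧ x ∈ cube c r ∧
          ((b : ℝ≥0∞) - l) * volume (cube c r) < ∫⁻ y in cube c r, (‖f y‖ₑ - l)} := by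
        refine measure_mono fun x hx => ?_
        simp only [mem_ofPred_eq, maximal, lt_iSup_iff] at hx
        obtain ⟨c, r, hr, hxc, hlt⟩ := hx
        refine ⟨c, r, hr, hxc, ?_⟩
        have hv0 := volume_cube_ne_zero c hr
        have hvt := volume_cube_ne_top c hr
        rw [mul_comm, ← div_eq_mul_inv, ENNReal.lt_div_iff_mul_lt (Or.inl hv0) (Or.inl hvt)] at hlt
        have h1 : ∫⁻ y in cube c r, ‖f y‖ₑ ≤
            (∫⁻ y in cube c r, (‖f y‖ₑ - l)) + l * volume (cube c r) := by
          rw [← setLIntegral_const, ← lintegral_add_right _ measurable_const]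
          exact lintegral_mono fun y => le_tsub_add
        have h2 := hlt.trans_le h1
        rw [ENNReal.sub_mul (fun _ _ => hvt)]
        exact ENNReal.sub_lt_of_lt_add (by gcongr) h2
    _ ≤ 5 ^ n * (((b : ℝ≥0∞) - l)⁻¹ * ∫⁻ y, (‖f y‖ₑ - l)) :=
        volume_exists_cube_lintegral_gt_le hn _ hd0 hdt
    _ ≤ 5 ^ n * (((b : ℝ≥0∞) - l)⁻¹ * (ENNReal.ofReal t * A)) := by
        rw [← hJA]; gcongr
    _ = ((b : ℝ≥0∞) - l)⁻¹ * (5 ^ n * A) * ENNReal.ofReal t := by ring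
    _ ≤ ((b : ℝ≥0∞) - l)⁻¹ * ((b : ℝ≥0∞) - l) * ENNReal.ofReal t := by gcongr
    _ = ENNReal.ofReal t := by rw [ENNReal.inv_mul_cancel hd0 hdt, one_mul]

/-! ### The running essential supremum -/

/-- The essential supremum of `φ` over `(0, s)`. -/
noncomputable def runningEssSup (φ : ℝ → ℝ≥0) (s : ℝ) : ℝ≥0∞ :=
  essSup (fun τ : ℝ => (φ τ : ℝ≥0∞)) (volume.restrict (Ioo 0 s))

theorem runningEssSup_mono (φ : ℝ → ℝ≥0) : Monotone (runningEssSup φ) := fun _ _ hst =>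
  essSup_mono_measure' (Measure.restrict_mono (Ioo_subset_Ioo_right hst) le_rfl)

/-- For rational right endpoints q the exceptional null sets can be united, giving φ(t) ≤ Φ(q) for
all rational q > t. Letting q decrease to t is allowed wherever Φ is continuous, which by
monotonicity excludes only countably many t. -/
theorem ae_le_runningEssSup (φ : ℝ → ℝ≥0) :
    ∀ᵐ t ∂(volume.restrict (Ioi (0 : ℝ))), (φ t : ℝ≥0∞) ≤ runningEssSup φ t := by
  have h1 : ∀ᵐ t ∂(volume : Measure ℝ), ∀ q : ℚ, t ∈ Ioo 0 (q : ℝ) →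
      (φ t : ℝ≥0∞) ≤ runningEssSup φ q := by
    refine ae_all_iff.2 fun q => ?_
    rw [← ae_restrict_iff' measurableSet_Ioo]
    exact ENNReal.ae_le_essSup _
  rw [ae_restrict_iff' measurableSet_Ioi]
  filter_upwards [h1, (runningEssSup_mono φ).countable_not_continuousAt.ae_notMem volume]
    with t ht hc ht0
  have hc : ContinuousAt (runningEssSup φ) t := by simpa using hc
  refine ge_of_tendsto (hc.tendsto.mono_left (nhdsWithin_le_nhds (s := Ioi t))) ?_
  filter_upwards [self_mem_nhdsWithin] with s hs
  obtain ⟨q, hq, hqs⟩ := exists_rat_btwn (mem_Ioi.1 hs)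
  exact (ht q ⟨ht0, hq⟩).trans (runningEssSup_mono φ hqs.le)

/-- As g* decreases, g*(s) ≤ g*(τ) for τ < s, so the constant g*(s) can be moved inside the
essential supremum over (0, s). -/
theorem runningEssSup_mul_rearrangement_le {n : ℕ} (φ : ℝ → ℝ≥0) (g : (Fin n → ℝ) → ℝ≥0∞)
    (s : ℝ) : runningEssSup φ s * rearrangement g s ≤ lorentzNorm φ g := by
  calc runningEssSup φ s * rearrangement g s
      = essSup (fun τ => rearrangement g s * (φ τ : ℝ≥0∞)) (volume.restrict (Ioo 0 s)) := by
        rw [ENNReal.essSup_const_mul, mul_comm]; rfl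
    _ ≤ essSup (fun τ => (φ τ : ℝ≥0∞) * rearrangement g τ) (volume.restrict (Ioo 0 s)) := by
        refine essSup_mono_ae ?_
        filter_upwards [ae_restrict_mem measurableSet_Ioo] with τ hτ
        rw [mul_comm]
        gcongr
        exact rearrangement_anti g hτ.2.le
    _ ≤ _ := essSup_mono_measure' (Measure.restrict_mono Ioo_subset_Ioi_self le_rfl)

/-- With 1/0 = ∞ the inner integral is infinite for every t > 0, so a finite bound forces φ(t) = 0.
This case is separated because f* ≤ ‖f‖/Φ can fail when ‖f‖ = 0 and Φ(s) = 0, the product 0 · ∞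
being 0. -/
theorem ae_eq_zero_of_runningEssSup_eq_zero {φ : ℝ → ℝ≥0} {K : ℝ≥0∞} (hK : K < ∞)
    (h : ∀ᵐ t ∂(volume.restrict (Ioi (0 : ℝ))), (φ t : ℝ≥0∞) / ENNReal.ofReal t *
      ∫⁻ s in Ioo 0 t, (runningEssSup φ s)⁻¹ ≤ K)
    {a : ℝ} (ha : 0 < a) (h0 : runningEssSup φ a = 0) :
    ∀ᵐ t ∂(volume.restrict (Ioi (0 : ℝ))), φ t = 0 := by
  filter_upwards [h, ae_restrict_mem measurableSet_Ioi] with t ht (ht0 : 0 < t)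
  by_contra hφ
  have hint : ∫⁻ s in Ioo 0 t, (runningEssSup φ s)⁻¹ = ∞ := by
    refine top_le_iff.1 ?_
    have hm : 0 < min a t := lt_min ha ht0
    calc ∞ = ∫⁻ _ in Ioo 0 (min a t), ∞ := by
          rw [setLIntegral_const, Real.volume_Ioo, sub_zero,
            ENNReal.top_mul (ENNReal.ofReal_pos.2 hm).ne']
      _ ≤ ∫⁻ s in Ioo 0 (min a t), (runningEssSup φ s)⁻¹ := by
          refine setLIntegral_mono' measurableSet_Ioo fun s hs => ?_
          have : runningEssSup φ s = 0 := le_bot_iff.1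
            ((runningEssSup_mono φ (hs.2.le.trans (min_le_left _ _))).trans h0.le)
          rw [this, ENNReal.inv_zero]
      _ ≤ _ := lintegral_mono_set (Ioo_subset_Ioo_right (min_le_right _ _))
  rw [hint, ENNReal.mul_top] at ht
  · exact hK.not_ge ht
  · exact (ENNReal.div_pos (by simpa using hφ) ENNReal.ofReal_ne_top).ne'

/-! ### Sufficiency of the condition -/

theorem maximalBounded_of_essSup_lt_top {n : ℕ} (hn : 1 ≤ n) {φ : ℝ → ℝ≥0}
    (h : essSup (fun t : ℝ => (φ t : ℝ≥0∞) / ENNReal.ofReal t *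
      ∫⁻ s in Ioo 0 t, (runningEssSup φ s)⁻¹) (volume.restrict (Ioi (0 : ℝ))) < ∞) :
    MaximalBounded n φ := by
  set K := essSup (fun t : ℝ => (φ t : ℝ≥0∞) / ENNReal.ofReal t *
      ∫⁻ s in Ioo 0 t, (runningEssSup φ s)⁻¹) (volume.restrict (Ioi (0 : ℝ))) with hKdef
  have hKae : ∀ᵐ t ∂(volume.restrict (Ioi (0 : ℝ))), (φ t : ℝ≥0∞) / ENNReal.ofReal t *
      ∫⁻ s in Ioo 0 t, (runningEssSup φ s)⁻¹ ≤ K := ENNReal.ae_le_essSup _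
  refine ⟨(5 ^ n + 1) * K.toNNReal, fun f hf => ?_⟩
  obtain ⟨hfm, hfN⟩ := hf
  refine essSup_le_of_ae_le _ ?_
  by_cases hpos : ∃ a, 0 < a ∧ runningEssSup φ a = 0
  · obtain ⟨a, ha, ha0⟩ := hpos
    filter_upwards [ae_eq_zero_of_runningEssSup_eq_zero h hKae ha ha0] with t ht
    simp [ht]
  push Not at hpos
  set N := lorentzNorm φ (fun x => ‖f x‖ₑ) with hN
  have hR : ∀ s, 0 < s → rearrangement (fun x => ‖f x‖ₑ) s ≤ N * (runningEssSup φ s)⁻¹ := by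
    intro s hs
    -- Where Φ(s) = ∞ the right-hand side is 0, and finiteness of the norm does force f*(s) = 0.
    rcases eq_or_ne (runningEssSup φ s) ∞ with ht | ht
    · have h1 := runningEssSup_mul_rearrangement_le φ (fun x => ‖f x‖ₑ) s
      rw [← hN, ht] at h1
      have h2 : rearrangement (fun x => ‖f x‖ₑ) s = 0 := by
        by_contra h3
        rw [ENNReal.top_mul h3] at h1
        exact hfN.not_ge h1
      rw [h2]
      exact bot_le
    · rw [← div_eq_mul_inv, ENNReal.le_div_iff_mul_le (Or.inl (hpos s hs)) (Or.inl ht), mul_comm]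
      exact runningEssSup_mul_rearrangement_le φ _ s
  filter_upwards [hKae, ae_restrict_mem measurableSet_Ioi] with t ht (ht0 : 0 < t)
  calc (φ t : ℝ≥0∞) * rearrangement (maximal f) t
      ≤ φ t * ((5 ^ n + 1) * ((ENNReal.ofReal t)⁻¹ *
          ∫⁻ s in Ioo 0 t, rearrangement (fun x => ‖f x‖ₑ) s)) := by
        gcongr
        exact rearrangement_maximal_le hn hfm ht0
    _ ≤ φ t * ((5 ^ n + 1) * ((ENNReal.ofReal t)⁻¹ *
          ∫⁻ s in Ioo 0 t, N * (runningEssSup φ s)⁻¹)) := by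
        gcongr _ * (_ * (_ * ?_))
        exact setLIntegral_mono' measurableSet_Ioo fun s hs => hR s hs.1
    _ = (5 ^ n + 1) * ((φ t : ℝ≥0∞) / ENNReal.ofReal t *
          ∫⁻ s in Ioo 0 t, (runningEssSup φ s)⁻¹) * N := by
        rw [lintegral_const_mul (f := fun s => (runningEssSup φ s)⁻¹) _
          (runningEssSup_mono φ).measurable.inv, div_eq_mul_inv]
        ring
    _ ≤ (5 ^ n + 1) * K * N := by gcongr
    _ = _ := by
        rw [ENNReal.coe_mul, ENNReal.coe_toNNReal h.ne]
        push_cast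
        rfl

/-! ### Necessity: radial test functions -/

/-- The volume of the smallest cube centred at the origin that contains `x`. -/
noncomputable def cubeVolume {n : ℕ} (x : Fin n → ℝ) : ℝ := (2 * ‖x‖) ^ n

theorem measurable_cubeVolume {n : ℕ} : Measurable (cubeVolume (n := n)) :=
  (measurable_norm.const_mul 2).pow_const n

theorem cubeVolume_nonneg {n : ℕ} (x : Fin n → ℝ) : 0 ≤ cubeVolume x := by
  unfold cubeVolume; positivity

theorem exists_pow_eq {n : ℕ} (hn : 1 ≤ n) {t : ℝ} (ht : 0 ≤ t) :
    ∃ r : ℝ, 0 ≤ r ∧ (2 * r) ^ n = t := by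
  refine ⟨t ^ ((n : ℝ)⁻¹) / 2, by positivity, ?_⟩
  rw [mul_div_cancel₀ _ two_ne_zero]
  exact Real.rpow_inv_natCast_pow ht (by omega)

theorem volume_cubeVolume_le {n : ℕ} (hn : 1 ≤ n) (t : ℝ) :
    volume {x : Fin n → ℝ | cubeVolume x ≤ t} = ENNReal.ofReal t := by
  rcases lt_or_ge t 0 with ht | ht
  · have : {x : Fin n → ℝ | cubeVolume x ≤ t} = ∅ :=
      eq_empty_of_forall_notMem fun x hx => (ht.trans_le (cubeVolume_nonneg x)).not_ge hx
    rw [this, measure_empty, ENNReal.ofReal_of_nonpos ht.le]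
  · obtain ⟨r, hr, rfl⟩ := exists_pow_eq hn ht
    have : {x : Fin n → ℝ | cubeVolume x ≤ (2 * r) ^ n} = cube 0 r := by
      ext x
      rw [cube_eq_closedBall 0 hr, mem_closedBall_zero_iff, mem_ofPred_eq, cubeVolume,
        pow_le_pow_iff_left₀ (by positivity) (by positivity) (by omega)]
      constructor <;> intro h <;> linarith
    rw [this, volume_cube _ hr]

/-- This reduces integrals of radial functions on ℝⁿ to integrals over the half-line. Sublevel sets
of `cubeVolume` are cubes of the prescribed volume, so the two measures agree on half-open
intervals. -/
theorem map_cubeVolume {n : ℕ} (hn : 1 ≤ n) :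
    (volume : Measure (Fin n → ℝ)).map cubeVolume = volume.restrict (Ioi (0 : ℝ)) := by
  refine (Measure.ext_of_Ioc _ _ fun a b hab => ?_).symm
  rw [Measure.restrict_apply measurableSet_Ioc,
    Measure.map_apply measurable_cubeVolume measurableSet_Ioc]
  have h1 : cubeVolume (n := n) ⁻¹' Ioc a b = {x | cubeVolume x ≤ b} \ {x | cubeVolume x ≤ a} := by
    ext x
    simp [and_comm]
  have h2 : {x : Fin n → ℝ | cubeVolume x ≤ a} ⊆ {x | cubeVolume x ≤ b} :=
    fun x hx => le_trans hx hab.le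
  rw [h1, measure_sdiff h2
    (measurableSet_le measurable_cubeVolume measurable_const).nullMeasurableSet
    (by rw [volume_cubeVolume_le hn]; exact ENNReal.ofReal_ne_top),
    volume_cubeVolume_le hn, volume_cubeVolume_le hn, Ioc_inter_Ioi, Real.volume_Ioc]
  rcases le_total 0 a with ha | ha
  · rw [sup_of_le_left ha, ENNReal.ofReal_sub _ ha]
  · rw [sup_of_le_right ha, ENNReal.ofReal_of_nonpos ha, sub_zero, tsub_zero]

/-- The running average of `w` is a lower bound for the maximal function of the radial function
with profile `w`. -/
theorem average_le_maximal {n : ℕ} (hn : 1 ≤ n) {w : ℝ → ℝ≥0} (hw : Measurable w)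
    {x : Fin n → ℝ} (hx : x ≠ 0) :
    (ENNReal.ofReal (cubeVolume x))⁻¹ * ∫⁻ s in Ioo 0 (cubeVolume x), (w s : ℝ≥0∞) ≤
      maximal (fun y => (w (cubeVolume y) : ℝ)) x := by
  have hx0 : 0 < ‖x‖ := norm_pos_iff.2 hx
  have hmem : x ∈ cube 0 ‖x‖ := by
    rw [cube_eq_closedBall 0 hx0.le]; simp
  refine le_trans (le_of_eq ?_) (le_iSup_of_le 0 (le_iSup_of_le ‖x‖ (le_iSup_of_le hx0
    (le_iSup_of_le hmem le_rfl))))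
  rw [volume_cube 0 hx0.le]
  change (ENNReal.ofReal ((2 * ‖x‖) ^ n))⁻¹ * _ = _
  congr 1
  have hset : cube 0 ‖x‖ = cubeVolume (n := n) ⁻¹' Iic (cubeVolume x) := by
    ext y
    rw [cube_eq_closedBall 0 hx0.le, mem_closedBall_zero_iff, mem_preimage, mem_Iic, cubeVolume,
      cubeVolume, pow_le_pow_iff_left₀ (by positivity) (by positivity) (by omega)]
    constructor <;> intro h <;> linarith
  have henorm : ∀ y : Fin n → ℝ, ‖(w (cubeVolume y) : ℝ)‖ₑ = (w (cubeVolume y) : ℝ≥0∞) := by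
    intro y; simp
  simp_rw [henorm]
  rw [hset, ← setLIntegral_map measurableSet_Iic hw.coe_nnreal_ennreal measurable_cubeVolume,
    map_cubeVolume hn, Measure.restrict_restrict measurableSet_Iic, Iic_inter_Ioi]
  exact setLIntegral_congr Ioo_ae_eq_Ioc

/-- On the shell t < `cubeVolume x` ≤ 3t the centred cube reaching x contains the mass ∫₀ᵗ w and has
volume at most 3t. The shell has measure 2t > t, so no level below the resulting average is
admissible in the infimum defining the rearrangement at t. Any factor above 2 would serve in place
of 3. -/
theorem average_le_rearrangement_maximal {n : ℕ} (hn : 1 ≤ n) {w : ℝ → ℝ≥0} (hw : Measurable w)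
    {t : ℝ} (ht : 0 < t) :
    (ENNReal.ofReal (3 * t))⁻¹ * ∫⁻ s in Ioo 0 t, (w s : ℝ≥0∞) ≤
      rearrangement (n := n) (maximal (fun y => (w (cubeVolume y) : ℝ))) t := by
  refine le_iInf fun α => le_iInf fun _ => le_iInf fun hα => ?_
  by_contra! hlt
  have hsub : cubeVolume (n := n) ⁻¹' Ioc t (3 * t) ⊆
      {x | (α : ℝ≥0∞) < maximal (fun y => (w (cubeVolume y) : ℝ)) x} := by
    rintro x ⟨hx1, hx2⟩
    have hx0 : x ≠ 0 := by
      rintro rfl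
      have : cubeVolume (0 : Fin n → ℝ) = 0 := by
        simp [cubeVolume, show n ≠ 0 by omega]
      linarith
    refine (hlt.trans_le ?_).trans_le (average_le_maximal hn hw hx0)
    exact mul_le_mul' (ENNReal.inv_le_inv.2 (ENNReal.ofReal_le_ofReal hx2))
      (lintegral_mono_set (Ioo_subset_Ioo_right hx1.le))
  have h1 := (measure_mono hsub).trans hα
  rw [← Measure.map_apply measurable_cubeVolume measurableSet_Ioc, map_cubeVolume hn,
    Measure.restrict_apply measurableSet_Ioc, Ioc_inter_Ioi, sup_of_le_left ht.le,
    Real.volume_Ioc, ENNReal.ofReal_le_ofReal_iff ht.le] at h1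
  linarith

/-- The truncation at height `k` of the reciprocal of the running essential supremum. -/
noncomputable def truncInv (φ : ℝ → ℝ≥0) (k : ℕ) (s : ℝ) : ℝ≥0 :=
  ((runningEssSup φ s)⁻¹ ⊓ (k : ℝ≥0∞)).toNNReal

theorem coe_truncInv (φ : ℝ → ℝ≥0) (k : ℕ) (s : ℝ) :
    (truncInv φ k s : ℝ≥0∞) = (runningEssSup φ s)⁻¹ ⊓ (k : ℝ≥0∞) :=
  ENNReal.coe_toNNReal (ne_top_of_le_ne_top (ENNReal.natCast_ne_top k) inf_le_right)

theorem measurable_truncInv (φ : ℝ → ℝ≥0) (k : ℕ) : Measurable (truncInv φ k) :=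
  ((runningEssSup_mono φ).measurable.inv.inf measurable_const).ennreal_toNNReal

theorem lintegral_inv_runningEssSup (φ : ℝ → ℝ≥0) (t : ℝ) :
    ∫⁻ s in Ioo 0 t, (runningEssSup φ s)⁻¹ =
      ⨆ k : ℕ, ∫⁻ s in Ioo 0 t, (truncInv φ k s : ℝ≥0∞) := by
  rw [← lintegral_iSup (fun k => (measurable_truncInv φ k).coe_nnreal_ennreal)]
  · refine lintegral_congr fun s => ?_
    simp_rw [coe_truncInv]
    rw [← inf_iSup_eq, ENNReal.iSup_natCast, inf_top_eq]
  · intro j k hjk s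
    simp only [coe_truncInv]
    gcongr

/-- The profile is decreasing and at most 1/Φ, so it exceeds a level b > 1/Φ(t) only where
`cubeVolume x` ≤ t, a set of measure t. Hence its rearrangement is at most 1/Φ, and φ ≤ Φ almost
everywhere finishes the bound, also when Φ(t) is 0 or ∞. -/
theorem lorentzNorm_truncInv_le_one {n : ℕ} (hn : 1 ≤ n) (φ : ℝ → ℝ≥0) (k : ℕ) :
    lorentzNorm φ (fun x : Fin n → ℝ => ‖(truncInv φ k (cubeVolume x) : ℝ)‖ₑ) ≤ 1 := by
  refine essSup_le_of_ae_le _ ?_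
  filter_upwards [ae_le_runningEssSup φ] with t ht
  have hR : rearrangement (fun x : Fin n → ℝ => ‖(truncInv φ k (cubeVolume x) : ℝ)‖ₑ) t ≤
      (runningEssSup φ t)⁻¹ := by
    refine le_of_forall_gt_imp_ge_of_dense fun b hb => ?_
    rcases eq_or_ne b ∞ with rfl | hbt
    · exact le_top
    lift b to ℝ≥0 using hbt
    refine rearrangement_le (ENNReal.coe_pos.1 (bot_le.trans_lt hb)) ?_
    rw [← volume_cubeVolume_le hn t]
    refine measure_mono fun x hx => ?_
    rw [mem_ofPred_eq] at hx ⊢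
    by_contra! hcon
    refine hx.not_ge (le_trans ?_ hb.le)
    have : ‖(truncInv φ k (cubeVolume x) : ℝ)‖ₑ = (truncInv φ k (cubeVolume x) : ℝ≥0∞) := by simp
    beta_reduce
    rw [this, coe_truncInv]
    exact inf_le_left.trans (ENNReal.inv_le_inv.2 (runningEssSup_mono φ hcon.le))
  calc (φ t : ℝ≥0∞) * _ ≤ runningEssSup φ t * (runningEssSup φ t)⁻¹ := mul_le_mul' ht hR
    _ ≤ 1 := ENNReal.mul_inv_le_one _

theorem essSup_lt_top_of_maximalBounded {n : ℕ} (hn : 1 ≤ n) {φ : ℝ → ℝ≥0}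
    (h : MaximalBounded n φ) :
    essSup (fun t : ℝ => (φ t : ℝ≥0∞) / ENNReal.ofReal t *
      ∫⁻ s in Ioo 0 t, (runningEssSup φ s)⁻¹) (volume.restrict (Ioi (0 : ℝ))) < ∞ := by
  obtain ⟨C, hC⟩ := h
  have hk : ∀ k : ℕ, ∀ᵐ t ∂(volume.restrict (Ioi (0 : ℝ))),
      (φ t : ℝ≥0∞) * rearrangement (n := n)
        (maximal (fun y => (truncInv φ k (cubeVolume y) : ℝ))) t ≤ C := by
    intro k
    have h1 := lorentzNorm_truncInv_le_one hn φ k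
    have h2 := hC (fun y => (truncInv φ k (cubeVolume y) : ℝ))
      ⟨((measurable_truncInv φ k).comp measurable_cubeVolume).coe_nnreal_real.aemeasurable,
        h1.trans_lt ENNReal.one_lt_top⟩
    filter_upwards [ENNReal.ae_le_essSup (μ := volume.restrict (Ioi (0 : ℝ)))
      (fun t => (φ t : ℝ≥0∞) * rearrangement (n := n)
        (maximal (fun y => (truncInv φ k (cubeVolume y) : ℝ))) t)] with t ht
    calc _ ≤ _ := ht
      _ ≤ _ := h2
      _ ≤ C * 1 := by gcongr
      _ = C := mul_one _
  refine lt_of_le_of_lt (essSup_le_of_ae_le (3 * C : ℝ≥0∞) ?_)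
    (ENNReal.mul_lt_top (by simp) ENNReal.coe_lt_top)
  -- One null set serves all k, so at a fixed t the bound 3C passes to the supremum over k by
  -- monotone convergence.
  filter_upwards [ae_all_iff.2 hk, ae_restrict_mem measurableSet_Ioi] with t ht (ht0 : 0 < t)
  rw [lintegral_inv_runningEssSup, ENNReal.mul_iSup]
  refine iSup_le fun k => ?_
  have h3 : (ENNReal.ofReal t)⁻¹ = 3 * (ENNReal.ofReal (3 * t))⁻¹ := by
    rw [ENNReal.ofReal_mul (by norm_num), ENNReal.ofReal_ofNat,
      ENNReal.mul_inv (by simp) (by simp), ← mul_assoc,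
      ENNReal.mul_inv_cancel (by simp) (by simp), one_mul]
  calc (φ t : ℝ≥0∞) / ENNReal.ofReal t * ∫⁻ s in Ioo 0 t, (truncInv φ k s : ℝ≥0∞)
      = 3 * (φ t * ((ENNReal.ofReal (3 * t))⁻¹ *
          ∫⁻ s in Ioo 0 t, (truncInv φ k s : ℝ≥0∞))) := by
        rw [div_eq_mul_inv, h3]; ring
    _ ≤ 3 * (φ t * rearrangement (n := n)
          (maximal (fun y => (truncInv φ k (cubeVolume y) : ℝ))) t) := by
        gcongr
        exact average_le_rearrangement_maximal hn (measurable_truncInv φ k) ht0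
    _ ≤ 3 * C := by gcongr; exact ht k

end GenLorentz

theorem mainTheorem4 (n : ℕ) (hn : 1 ≤ n) (φ : ℝ → ℝ≥0)
    (hφ : AEMeasurable φ (volume.restrict (Ioi (0 : ℝ)))) :
    GenLorentz.MaximalBounded n φ ↔
      essSup (fun t : ℝ => (φ t : ℝ≥0∞) / ENNReal.ofReal t *
          ∫⁻ s in Ioo 0 t, (essSup (fun τ : ℝ => (φ τ : ℝ≥0∞)) (volume.restrict (Ioo 0 s)))⁻¹)
        (volume.restrict (Ioi (0 : ℝ))) < ∞ :=
  ⟨GenLorentz.essSup_lt_top_of_maximalBounded hn, GenLorentz.maximalBounded_of_essSup_lt_top hn⟩
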